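/- **Notation.** For $r\in\mathbb R$ let $S^r$ be the set of $\sigma\in C^\infty(\mathbb R^3\times\mathbb R^3;\mathbb C)$ such that for all multi-indices $\alpha,\beta$ there is a constant $C_{\alpha,\beta}$ with $|\partial_x^\alpha\partial_\xi^\beta\sigma(x,\xi)|\le C_{\alpha,\beta}(1+|\xi|)^{r-|\beta|}$ for all $x,\xi$. For $\sigma\in S^r$ and $\varphi\in\mathscr S(\mathbb R^3)$ put $(T_\sigma\varphi)(x)=(2\pi)^{-3}\int e^{ix\cdot\xi}\sigma(x,\xi)\int e^{-iy\cdot\xi}\varphi(y)\,dy\,d\xi$. Let $(\Omega,\mathbb P)$ be a probability space, $D_f\subset\mathbb R^3$ bounded and $m\in\mathbb R$. A *microlocally isotropic Gaussian random field of rough order $-m$ and rough strength $\mu$ in $D_f$* is a random tempered distribution $f(\cdot,\omega)\in\mathscr S'(\mathbb R^3)$ such that 1. $\langle f,\varphi\rangle$ is a (complex, possibly degenerate) Gaussian random variable for every $\varphi\in\mathscr S(\mathbb R^3)$; 2. $\mathbb E f\in C_c^\infty(\mathbb R^3)$ and $\operatorname{supp}\mathbb E f\subset D_f$, where $\langle\mathbb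 Ef,\varphi\rangle=\mathbb E\langle f,\varphi\rangle$; 3. $\operatorname{supp}f\subset D_f$ almost surely; 4. the covariance operator $\mathfrak C_f$, given by $(\mathfrak C_f\varphi)(\psi)=\mathbb E\big(\langle\overline{f-\mathbb Ef},\varphi\rangle\,\langle f-\mathbb Ef,\psi\rangle\big)$ for $\varphi,\psi\in\mathscr S(\mathbb R^3)$, is the pseudodifferential operator $T_c$ of some symbol $c\in S^{-m}$, that is, $(\mathfrak C_f\varphi)(\psi)=\int (T_c\varphi)(x)\,\psi(x)\,dx$; 5. $c$ has principal symbol $\mu(x)|\xi|^{-m}$, that is, $c(x,\xi)-(1-\chi(\xi))\mu(x)|\xi|^{-m}\in S^{-m-1}$ for a cutoff $\chi\in C_c^\infty(\mathbb R^3)$ with $\chi=1$ near $0$, where $\mu\in C_c^\infty(\mathbb R^3;\mathbb R)$, $\mu\ge0$ and $\operatorname{supp}\mu\subset D_f$. For $k>0$ let $(\mathcal R_k\varphi)(x)=\int_{\mathbb R^3}\frac{e^{ik|x-y|}}{4\pi|x-y|}\varphi(y)\,dy$ for $\varphi\in C_c^\infty(\mathbb R^3)$; this is a smooth function. For a compactly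 supported distribution $g$, the distribution $\mathcal R_kg$ is given by $\langle\mathcal R_kg,\varphi\rangle=\langle g,\mathcal R_k\varphi\rangle$ for $\varphi\in C_c^\infty(\mathbb R^3)$, where the pairing of $g$ with a smooth function $v$ is $\langle g,\chi v\rangle$ for any $\chi\in C_c^\infty(\mathbb R^3)$ equal to $1$ near $\operatorname{supp}g$. For $\delta\in\mathbb R$ let $L^2_\delta(\mathbb R^3)$ be the space of $u\in L^1_{\rm loc}(\mathbb R^3)$ with $\int(1+|x|^2)^{\delta}|u(x)|^2\,dx<\infty$. **Lemma 2.2.** Let $m>2$, let $D_f\subset\mathbb R^3$ be bounded, and let $f$ be a microlocally isotropic Gaussian random field of rough order $-m$ in $D_f$. Then for every $k>0$, almost surely, $\mathcal R_kf\in L^2_{-1/2-\epsilon}(\mathbb R^3)$ for every $\epsilon>0$; that is, the distribution $\mathcal R_kf$ is given by a function in $L^2_{-1/2-\epsilon}(\mathbb R^3)$. -/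

import Mathlib

open MeasureTheory ProbabilityTheory Filter Topology
open scoped SchwartzMap

namespace RandomScattering

noncomputable section

open scoped ContDiff ComplexConjugate

/-- `ℝⁿ` with its Euclidean norm. -/
abbrev RSpace (n : ℕ) : Type := EuclideanSpace ℝ (Fin n)

/-! ### Symbols and pseudodifferential operators -/

/-- The Kohn–Nirenberg symbol class `S^r`: smooth `σ(x, ξ)` all of whose mixed derivatives, of order
`a` in `x` and `b` in `ξ`, are bounded by `C_{a,b} (1 + |ξ|)^{r - b}`.  The derivatives of given
orders are collected in the iterated Fréchet derivative, whose norm controls, and is controlled by,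
the partial derivatives `∂_x^α ∂_ξ^β σ` with `|α| = a`, `|β| = b`. -/
def IsSymbol {n : ℕ} (r : ℝ) (σ : RSpace n → RSpace n → ℂ) : Prop :=
  ContDiff ℝ ∞ (fun p : RSpace n × RSpace n => σ p.1 p.2) ∧
  ∀ a b : ℕ, ∃ C : ℝ, ∀ x ξ : RSpace n,
    ‖iteratedFDeriv ℝ a (fun x' => iteratedFDeriv ℝ b (σ x') ξ) x‖
      ≤ C * (1 + ‖ξ‖) ^ (r - (b : ℝ))

/-- The symbol `c ∈ S^{-m}` has principal symbol `μ(x) |ξ|^{-m}`: the difference is in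
`S^{-m-1}`.  As `|ξ|^{-m}` is not smooth at `ξ = 0`, it is multiplied by `1 - χ(ξ)` where `χ` is
a cutoff function equal to `1` near `0`; the choice of `χ` does not matter. -/
def HasPrincipalSymbol {n : ℕ} (c : RSpace n → RSpace n → ℂ) (m : ℝ) (μ : RSpace n → ℝ) : Prop :=
  ∃ χ : RSpace n → ℝ, ContDiff ℝ ∞ χ ∧ HasCompactSupport χ ∧ (∀ᶠ ξ in 𝓝 0, χ ξ = 1) ∧
    IsSymbol (-m - 1) (fun x ξ => c x ξ - (((1 - χ ξ) * (μ x * ‖ξ‖ ^ (-m)) : ℝ) : ℂ))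

/-- The pseudodifferential operator with symbol `σ`,
`(T_σ φ)(x) = (2π)^{-n} ∫ e^{i x·ξ} σ(x, ξ) (∫ e^{-i y·ξ} φ(y) dy) dξ`. -/
def pseudoDiff {n : ℕ} (σ : RSpace n → RSpace n → ℂ) (φ : 𝓢(RSpace n, ℂ)) (x : RSpace n) : ℂ :=
  (((2 * Real.pi) ^ n : ℝ) : ℂ)⁻¹ *
    ∫ ξ : RSpace n, Complex.exp (Complex.I * (inner ℝ x ξ : ℝ)) * σ x ξ *
      ∫ y : RSpace n, Complex.exp (-(Complex.I * (inner ℝ y ξ : ℝ))) * φ y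

/-! ### Microlocally isotropic Gaussian random fields -/

/-- The complex conjugate of a Schwartz function. -/
def conjSchwartz {n : ℕ} (φ : 𝓢(RSpace n, ℂ)) : 𝓢(RSpace n, ℂ) :=
  SchwartzMap.postcompCLM (𝕜 := ℝ) (Complex.conjCLE : ℂ →L[ℝ] ℂ) φ

/-- The covariance of a random distribution,
`(𝔠_f φ)(ψ) = 𝔼(⟨conj(f - 𝔼f), φ⟩ ⟨f - 𝔼f, ψ⟩)`, where the conjugate of a distribution `u` is
given by `⟨conj u, φ⟩ = conj ⟨u, conj φ⟩`, so that `𝔠_f` is bilinear in `(φ, ψ)`. -/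
def covariancePairing {n : ℕ} {Ω : Type*} [MeasurableSpace Ω] (P : Measure Ω)
    (f : Ω → 𝓢'(RSpace n, ℂ)) (φ ψ : 𝓢(RSpace n, ℂ)) : ℂ :=
  ∫ w, conj (f w (conjSchwartz φ) - ∫ w', f w' (conjSchwartz φ) ∂P) *
    (f w ψ - ∫ w', f w' ψ ∂P) ∂P

/-- `f` is a microlocally isotropic generalized Gaussian random field (migr field) on `ℝⁿ` with
rough order `-m` and rough strength `μ` in the set `D`.  As `f w` is linear, Gaussianity of each
single complex random variable `⟨f, φ⟩` gives joint Gaussianity of finitely many of them.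
The covariance operator is a pseudodifferential operator with a symbol in `S^{-m}` and principal
symbol `μ(x) |ξ|^{-m}`; no homogeneous expansion of the lower order terms is required, so fields
whose covariance symbol is polyhomogeneous are included. -/
structure IsMigrField {n : ℕ} {Ω : Type*} [MeasurableSpace Ω] (P : Measure Ω)
    (f : Ω → 𝓢'(RSpace n, ℂ)) (m : ℝ) (μ : RSpace n → ℝ) (D : Set (RSpace n)) : Prop where
  gaussian : ∀ φ : 𝓢(RSpace n, ℂ), HasGaussianLaw (fun w => f w φ) P
  expectation : ∃ g : RSpace n → ℂ, ContDiff ℝ ∞ g ∧ HasCompactSupport g ∧ tsupport g ⊆ D ∧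
    ∀ φ : 𝓢(RSpace n, ℂ), ∫ w, f w φ ∂P = ∫ x, g x * φ x
  support_subset : ∀ᵐ w ∂P, Distribution.dsupport (f w) ⊆ D
  strength_contDiff : ContDiff ℝ ∞ μ
  strength_hasCompactSupport : HasCompactSupport μ
  strength_tsupport_subset : tsupport μ ⊆ D
  strength_nonneg : ∀ x, 0 ≤ μ x
  covariance : ∃ c : RSpace n → RSpace n → ℂ, IsSymbol (-m) c ∧ HasPrincipalSymbol c m μ ∧
    ∀ φ ψ : 𝓢(RSpace n, ℂ), covariancePairing P f φ ψ = ∫ x, pseudoDiff c φ x * ψ x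

/-! ### Weighted `L²` spaces -/

/-- `u ∈ L²_δ(ℝⁿ)`: `u` is locally integrable and `(1 + |x|²)^{δ/2} u` is square integrable. -/
def MemWeightedL2 {n : ℕ} (δ : ℝ) (u : RSpace n → ℂ) : Prop :=
  LocallyIntegrable u volume ∧
    MemLp (fun x => (((1 + ‖x‖ ^ 2) ^ (δ / 2) : ℝ) : ℂ) * u x) 2 volume

/-! ### The resolvent in three dimensions -/

/-- The outgoing fundamental solution `Φ_k(x, y) = e^{ik|x-y|} / (4π|x-y|)` of `-Δ - k²`. -/
def outgoingKernel (k : ℝ) (x y : RSpace 3) : ℂ :=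
  Complex.exp (Complex.I * k * ‖x - y‖) / (4 * Real.pi * ‖x - y‖)

/-- The resolvent `(R_k φ)(x) = ∫ Φ_k(x, y) φ(y) dy` on functions. -/
def resolvent (k : ℝ) (φ : RSpace 3 → ℂ) (x : RSpace 3) : ℂ :=
  ∫ y, outgoingKernel k x y * φ y

theorem locallyIntegrable_outgoingKernel (k : ℝ) :
    LocallyIntegrable (fun x => outgoingKernel k x 0) (volume : Measure (RSpace 3)) := by
  have hmeas : Measurable (fun x => outgoingKernel k x 0) := by
    unfold outgoingKernel
    fun_prop
  have hloc : LocallyIntegrable (fun x : RSpace 3 => ‖x‖⁻¹) volume := by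
    rw [locallyIntegrable_iff]
    intro K hK
    obtain ⟨r, hr⟩ := hK.isBounded.subset_ball 0
    refine IntegrableOn.mono_set ?_ hr
    rw [integrableOn_fun_norm_addHaar (μ := volume) (f := fun t : ℝ => t⁻¹)]
    have hid : IntegrableOn (fun t : ℝ => t) (Set.Ioo 0 r) volume :=
      (continuous_id.integrableOn_Icc (a := 0) (b := r)).mono_set Set.Ioo_subset_Icc_self
    refine hid.congr_fun (fun t ht => ?_) measurableSet_Ioo
    have : t ≠ 0 := ht.1.ne'
    simp only [finrank_euclideanSpace, Fintype.card_fin, smul_eq_mul]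
    field_simp
  refine hloc.mono hmeas.aestronglyMeasurable (Eventually.of_forall fun x => ?_)
  have h : ‖Complex.exp (Complex.I * k * ‖x‖)‖ = 1 := by
    rw [Complex.norm_exp]
    simp
  simp only [outgoingKernel, sub_zero, norm_div, h, norm_mul, Complex.norm_real, norm_norm,
    Complex.norm_ofNat, norm_inv, Real.norm_of_nonneg Real.pi_pos.le, one_div, mul_inv]
  have h4 : (4 : ℝ)⁻¹ * Real.pi⁻¹ ≤ 1 := by
    rw [← mul_inv]
    exact inv_le_one_of_one_le₀ (by nlinarith [Real.pi_gt_three])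
  exact mul_le_of_le_one_left (by positivity) h4

theorem contDiff_resolvent (k : ℝ) {φ : RSpace 3 → ℂ} (h₁ : ContDiff ℝ ∞ φ)
    (h₂ : HasCompactSupport φ) : ContDiff ℝ ∞ (resolvent k φ) := by
  have h := h₂.contDiff_convolution_left (ContinuousLinearMap.mul ℝ ℂ) h₁
    (locallyIntegrable_outgoingKernel k)
  convert h using 1
  ext x
  simp only [resolvent, convolution, ContinuousLinearMap.mul_apply']
  refine integral_congr_ae (Eventually.of_forall fun y => ?_)
  simp [outgoingKernel, mul_comm]

/-- A smooth compactly supported function on `ℝ³`. -/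
structure TestFn where
  toFun : RSpace 3 → ℂ
  smooth : ContDiff ℝ ∞ toFun
  compactSupport : HasCompactSupport toFun

/-- The test function `χ · R_k φ`, which is smooth with compact support. -/
def cutoffResolvent (k : ℝ) (χ φ : TestFn) : 𝓢(RSpace 3, ℂ) :=
  HasCompactSupport.toSchwartzMap (f := fun x => χ.toFun x * resolvent k φ.toFun x)
    χ.compactSupport.mul_right
    (χ.smooth.mul (contDiff_resolvent k φ.smooth φ.compactSupport))

/-- For a compactly supported distribution `f`, the distribution `R_k f = Φ_k * f` is given by the
function `u`.  Since `Φ_k(x, y) = Φ_k(y, x)`, the distribution `R_k f` is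
`⟨R_k f, φ⟩ = ⟨f, R_k φ⟩` for `φ ∈ C_c^∞`.  Here `R_k φ` is smooth, and the pairing with the
compactly supported `f` is `⟨f, χ R_k φ⟩`, for any cutoff function `χ` that is `1` near
the support of `f`. -/
def IsResolventOf (k : ℝ) (f : 𝓢'(RSpace 3, ℂ)) (u : RSpace 3 → ℂ) : Prop :=
  IsCompact (Distribution.dsupport f) ∧ LocallyIntegrable u volume ∧
  ∀ χ φ : TestFn, (∀ᶠ x in 𝓝ˢ (Distribution.dsupport f), χ.toFun x = 1) →
    f (cutoffResolvent k χ φ) = ∫ x, u x * φ.toFun x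

/-- `R_k f ∈ L²_δ(ℝ³)` for a compactly supported distribution `f`. -/
def ResolventMemWeightedL2 (k : ℝ) (f : 𝓢'(RSpace 3, ℂ)) (δ : ℝ) : Prop :=
  ∃ u : RSpace 3 → ℂ, IsResolventOf k f u ∧ MemWeightedL2 δ u

end

end RandomScattering

namespace RandomScattering

open scoped ContDiff ComplexConjugate

noncomputable section

/-! ### The covariance is bounded on `L²` -/

/-! The proof is a Hilbert–Schmidt argument based on second moments. Since $2m>3$, the function
$(1+|\xi|)^{-m}$ is square integrable, so Cauchy–Schwarz and Plancherel bound $T_c$ from $L^2$ to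
$L^\infty$. Hence $\mathbb E|\langle f,\psi\rangle|^2\le C\|\psi\|_{L^2}^2$ for $\psi$ supported in
a fixed compact set (`IsMigrField.exists_lintegral_sq_le`).

Let $J\varphi=(1+|x|^2)^\delta\varphi$ with $\delta>1/4$. The kernel
$\chi(y)\Phi_k(y,x)(1+|x|^2)^{-\delta}$ is square integrable, so Bessel's inequality gives
$\sum_i\|\chi\mathcal R_kv_i\|^2<\infty$ whenever $(Jv_i)$ is orthonormal
(`exists_tsum_lintegral_cutoffResolventLM_le`). Together, $\mathbb E\sum_i|\langle f,\chi\mathcal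
R_kv_i\rangle|^2<\infty$, so almost surely the coefficients are square summable and define $h\in
L^2$ with $\langle f,\chi\mathcal R_k\varphi\rangle=(h,J\varphi)$ on the span of the $v_i$. The
function sought is $u=(1+|x|^2)^\delta\bar h\in L^2_{-2\delta}$.

The identity must hold for all test functions outside one null set. So the $v_i$ come from
Gram–Schmidt applied to a sequence dense in the test functions, with supports controlled, and the
identity extends by continuity of each realisation of $f$ and of $\varphi\mapsto\chi\mathcal
R_k\varphi$. -/

theorem integral_norm_mul_norm_le_sqrt {α E F : Type*} [MeasurableSpace α] {ν : Measure α}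
    [NormedAddCommGroup E] [NormedAddCommGroup F] {f : α → E} {g : α → F}
    (hf : MemLp f 2 ν) (hg : MemLp g 2 ν) :
    ∫ x, ‖f x‖ * ‖g x‖ ∂ν ≤ √(∫ x, ‖f x‖ ^ 2 ∂ν) * √(∫ x, ‖g x‖ ^ 2 ∂ν) := by
  have h := integral_mul_le_Lp_mul_Lq_of_nonneg (μ := ν) Real.HolderConjugate.two_two
    (f := fun x => ‖f x‖) (g := fun x => ‖g x‖)
    (Eventually.of_forall fun _ => norm_nonneg _) (Eventually.of_forall fun _ => norm_nonneg _)
    (by simpa using hf.norm) (by simpa using hg.norm)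
  simpa [Real.sqrt_eq_rpow] using h

theorem ofReal_integral_sq_norm {α E : Type*} [MeasurableSpace α] {ν : Measure α}
    [NormedAddCommGroup E] {f : α → E} (hf : MemLp f 2 ν) :
    ENNReal.ofReal (∫ x, ‖f x‖ ^ 2 ∂ν) = ∫⁻ x, ‖f x‖ₑ ^ 2 ∂ν := by
  rw [ofReal_integral_eq_lintegral_ofReal (hf.integrable_norm_pow (by norm_num))
    (Eventually.of_forall fun _ => by positivity)]
  refine lintegral_congr fun x => ?_
  rw [ENNReal.ofReal_pow (norm_nonneg _), ofReal_norm]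

theorem IsSymbol.exists_norm_le {n : ℕ} {r : ℝ} {σ : RSpace n → RSpace n → ℂ}
    (h : IsSymbol r σ) : ∃ C : ℝ, 0 ≤ C ∧ ∀ x ξ, ‖σ x ξ‖ ≤ C * (1 + ‖ξ‖) ^ r := by
  obtain ⟨C, hC⟩ := h.2 0 0
  have hC' : ∀ x ξ, ‖σ x ξ‖ ≤ C * (1 + ‖ξ‖) ^ r := by
    intro x ξ
    have := hC x ξ
    rw [norm_iteratedFDeriv_zero, norm_iteratedFDeriv_zero] at this
    simpa using this
  refine ⟨C, ?_, hC'⟩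
  have := (norm_nonneg _).trans (hC' 0 0)
  simpa using this

theorem integral_exp_mul_eq_fourier {n : ℕ} (φ : 𝓢(RSpace n, ℂ)) (ξ : RSpace n) :
    ∫ y : RSpace n, Complex.exp (-(Complex.I * (inner ℝ y ξ : ℝ))) * φ y =
      FourierTransform.fourier φ ((2 * Real.pi)⁻¹ • ξ) := by
  rw [SchwartzMap.fourier_coe, Real.fourier_eq']
  refine integral_congr_ae (Eventually.of_forall fun y => ?_)
  simp only [smul_eq_mul, inner_smul_right]
  congr 2
  have hpi : (Real.pi : ℂ) ≠ 0 := by exact_mod_cast Real.pi_ne_zero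
  push_cast
  field_simp

theorem memLp_one_add_norm_rpow {n : ℕ} {m : ℝ} (hm : n < 2 * m) :
    MemLp (fun ξ : RSpace n => (1 + ‖ξ‖) ^ (-m)) 2 volume := by
  have hmeas : AEStronglyMeasurable (fun ξ : RSpace n => (1 + ‖ξ‖) ^ (-m)) volume := by
    have : Measurable (fun ξ : RSpace n => (1 + ‖ξ‖) ^ (-m)) := by fun_prop
    exact this.aestronglyMeasurable
  rw [memLp_two_iff_integrable_sq_norm hmeas]
  refine (integrable_one_add_norm (r := 2 * m) (by simpa using hm)).congr
    (Eventually.of_forall fun ξ => ?_)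
  have h0 : 0 ≤ 1 + ‖ξ‖ := by positivity
  simp only [Real.norm_eq_abs, sq_abs]
  rw [← Real.rpow_natCast, ← Real.rpow_mul h0]
  congr 1
  push_cast
  ring

/-- Cauchy–Schwarz in $\xi$ pairs the symbol's decay with $\hat\varphi$, and Plancherel returns
$\|\varphi\|_{L^2}$. Only the size of the symbol matters, not its derivatives. -/
theorem exists_norm_pseudoDiff_le {n : ℕ} {m : ℝ} (hm : n < 2 * m)
    {c : RSpace n → RSpace n → ℂ} (hc : IsSymbol (-m) c) :
    ∃ C : ℝ, 0 ≤ C ∧ ∀ (φ : 𝓢(RSpace n, ℂ)) (x : RSpace n),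
      ‖pseudoDiff c φ x‖ ≤ C * √(∫ y, ‖φ y‖ ^ 2) := by
  obtain ⟨C, hC0, hC⟩ := hc.exists_norm_le
  have hpi : (2 * Real.pi)⁻¹ ≠ 0 := by positivity
  set A : ℝ := √(∫ ξ : RSpace n, ‖(1 + ‖ξ‖) ^ (-m)‖ ^ 2) with hA
  -- The square root of the Jacobian of the dilation $\xi\mapsto\xi/2\pi$ between the two Fourier
  -- normalisations.
  set B : ℝ := √(|(((2 * Real.pi)⁻¹ ^ Module.finrank ℝ (RSpace n))⁻¹)|) with hB
  refine ⟨((2 * Real.pi) ^ n)⁻¹ * (C * (A * B)), by positivity, fun φ x => ?_⟩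
  set F : RSpace n → ℂ := fun ξ => FourierTransform.fourier φ ((2 * Real.pi)⁻¹ • ξ) with hF
  have hF_int : ∫ ξ, ‖F ξ‖ ^ 2 =
      |(((2 * Real.pi)⁻¹ ^ Module.finrank ℝ (RSpace n))⁻¹)| * ∫ y, ‖φ y‖ ^ 2 := by
    rw [← SchwartzMap.integral_norm_sq_fourier φ]
    exact Measure.integral_comp_smul volume
      (fun ξ => ‖FourierTransform.fourier φ ξ‖ ^ 2) (2 * Real.pi)⁻¹
  have hF_memLp : MemLp F 2 volume := by
    have hmeas : AEStronglyMeasurable F volume :=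
      ((FourierTransform.fourier φ).continuous.comp (continuous_const_smul _)).aestronglyMeasurable
    rw [memLp_two_iff_integrable_sq_norm hmeas]
    have h2 : Integrable (fun ξ => ‖FourierTransform.fourier φ ξ‖ ^ 2) volume :=
      ((FourierTransform.fourier φ).memLp 2).integrable_norm_pow (by norm_num)
    exact h2.comp_smul hpi
  have hw := memLp_one_add_norm_rpow hm
  have hint : Integrable (fun ξ : RSpace n => C * (‖(1 + ‖ξ‖) ^ (-m)‖ * ‖F ξ‖)) volume :=
    (hw.norm.integrable_mul hF_memLp.norm).const_mul C
  have hle : ‖∫ ξ : RSpace n, Complex.exp (Complex.I * (inner ℝ x ξ : ℝ)) * c x ξ *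
      ∫ y : RSpace n, Complex.exp (-(Complex.I * (inner ℝ y ξ : ℝ))) * φ y‖ ≤
      ∫ ξ : RSpace n, C * (‖(1 + ‖ξ‖) ^ (-m)‖ * ‖F ξ‖) := by
    refine norm_integral_le_of_norm_le hint (Eventually.of_forall fun ξ => ?_)
    rw [integral_exp_mul_eq_fourier, norm_mul, norm_mul, mul_comm Complex.I,
      Complex.norm_exp_ofReal_mul_I, one_mul, ← mul_assoc]
    refine mul_le_mul_of_nonneg_right ?_ (norm_nonneg _)
    rw [Real.norm_of_nonneg (by positivity)]
    exact hC x ξ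
  rw [pseudoDiff, norm_mul, norm_inv, Complex.norm_real, Real.norm_of_nonneg (by positivity),
    mul_assoc]
  refine mul_le_mul_of_nonneg_left (hle.trans ?_) (by positivity)
  rw [integral_const_mul, mul_assoc]
  refine mul_le_mul_of_nonneg_left ((integral_norm_mul_norm_le_sqrt hw hF_memLp).trans ?_) hC0
  rw [hF_int, Real.sqrt_mul (abs_nonneg _), mul_assoc]

theorem norm_integral_mul_le_of_tsupport_subset {n : ℕ} {K : Set (RSpace n)} (hK : IsCompact K)
    {u : RSpace n → ℂ} {M : ℝ} (hu : ∀ x, ‖u x‖ ≤ M) (ψ : 𝓢(RSpace n, ℂ))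
    (hψ : ∀ x ∉ K, ψ x = 0) :
    ‖∫ x, u x * ψ x‖ ≤ M * (√(volume.real K) * √(∫ x, ‖ψ x‖ ^ 2)) := by
  have hM : 0 ≤ M := (norm_nonneg _).trans (hu 0)
  have h1 : MemLp (K.indicator fun _ => (1 : ℝ)) 2 (volume : Measure (RSpace n)) :=
    memLp_indicator_const 2 hK.measurableSet 1 (Or.inr hK.measure_lt_top.ne)
  have h2 := integral_norm_mul_norm_le_sqrt h1 (ψ.memLp 2)
  have hint : Integrable (fun x => ‖K.indicator (fun _ => (1 : ℝ)) x‖ * ‖ψ x‖) volume :=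
    h1.norm.integrable_mul (ψ.memLp 2).norm
  have h3 : ∫ x : RSpace n, ‖K.indicator (fun _ => (1 : ℝ)) x‖ ^ 2 = volume.real K := by
    rw [← integral_indicator_one hK.measurableSet]
    congr 1
    ext x
    by_cases hx : x ∈ K <;> simp [hx]
  rw [h3] at h2
  refine (norm_integral_le_of_norm_le (hint.const_mul M)
    (Eventually.of_forall fun x => ?_)).trans ?_
  · by_cases hx : x ∈ K
    · simpa [hx] using mul_le_mul_of_nonneg_right (hu x) (norm_nonneg (ψ x))
    · simp [hψ x hx]
  · rw [integral_const_mul]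
    exact mul_le_mul_of_nonneg_left h2 hM

theorem conjSchwartz_apply {n : ℕ} (φ : 𝓢(RSpace n, ℂ)) (x : RSpace n) :
    conjSchwartz φ x = conj (φ x) := by
  simp [conjSchwartz]

theorem conjSchwartz_conjSchwartz {n : ℕ} (φ : 𝓢(RSpace n, ℂ)) :
    conjSchwartz (conjSchwartz φ) = φ := by
  ext x
  simp [conjSchwartz_apply]

/-- The covariance tested on $(\bar\psi,\psi)$ is the variance of $\langle f,\psi\rangle$. Both it
and the mean are integrals of a bounded function against $\psi$, hence controlled by
$|K|^{1/2}\|\psi\|_{L^2}$. -/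
theorem IsMigrField.exists_lintegral_sq_le {n : ℕ} {Ω : Type*} [MeasurableSpace Ω]
    {P : Measure Ω} [IsProbabilityMeasure P] {f : Ω → 𝓢'(RSpace n, ℂ)} {m : ℝ}
    {μ : RSpace n → ℝ} {D : Set (RSpace n)} (hf : IsMigrField P f m μ D) (hm : n < 2 * m)
    {K : Set (RSpace n)} (hK : IsCompact K) :
    ∃ C : ℝ, 0 ≤ C ∧ ∀ ψ : 𝓢(RSpace n, ℂ), (∀ x ∉ K, ψ x = 0) →
      ∫⁻ w, ‖f w ψ‖ₑ ^ 2 ∂P ≤ ENNReal.ofReal (C * ∫ x, ‖ψ x‖ ^ 2) := by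
  obtain ⟨c, hc, -, hcov⟩ := hf.covariance
  obtain ⟨C, hC0, hC⟩ := exists_norm_pseudoDiff_le hm hc
  obtain ⟨g, hg_smooth, hg_supp, -, hg⟩ := hf.expectation
  obtain ⟨G, hG⟩ := hg_supp.exists_bound_of_continuous hg_smooth.continuous
  have hG0 : 0 ≤ G := (norm_nonneg _).trans (hG 0)
  refine ⟨2 * (C * √(volume.real K) + (G * √(volume.real K)) ^ 2), by positivity,
    fun ψ hψ => ?_⟩
  set I : ℝ := ∫ x, ‖ψ x‖ ^ 2 with hI
  have hI0 : 0 ≤ I := integral_nonneg fun _ => by positivity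
  set X : Ω → ℂ := fun w => f w ψ with hX
  set e : ℂ := ∫ w, X w ∂P with he
  have hXL : MemLp X 2 P := (hf.gaussian ψ).memLp_two
  have he_le : ‖e‖ ≤ G * (√(volume.real K) * √I) := by
    rw [he, hX, hg ψ]
    exact norm_integral_mul_le_of_tsupport_subset hK hG ψ hψ
  have hXe : MemLp (fun w => X w - e) 2 P := hXL.sub (memLp_const e)
  have hvar : ∫ w, ‖X w - e‖ ^ 2 ∂P ≤ C * √(volume.real K) * I := by
    have h1 := hcov (conjSchwartz ψ) ψ
    rw [covariancePairing, conjSchwartz_conjSchwartz] at h1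
    have h2 : ∫ w, conj (f w ψ - ∫ w', f w' ψ ∂P) * (f w ψ - ∫ w', f w' ψ ∂P) ∂P =
        ((∫ w, ‖X w - e‖ ^ 2 ∂P : ℝ) : ℂ) := by
      rw [← integral_complex_ofReal]
      refine integral_congr_ae (Eventually.of_forall fun w => ?_)
      change conj (X w - e) * (X w - e) = _
      rw [mul_comm, Complex.mul_conj, Complex.normSq_eq_norm_sq]
    rw [h2] at h1
    have h3 : ∫ w, ‖X w - e‖ ^ 2 ∂P = ‖∫ x, pseudoDiff c (conjSchwartz ψ) x * ψ x‖ := by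
      rw [← h1, Complex.norm_real, Real.norm_of_nonneg (integral_nonneg fun _ => by positivity)]
    rw [h3]
    refine (norm_integral_mul_le_of_tsupport_subset hK (hC _) ψ hψ).trans (le_of_eq ?_)
    have h4 : ∫ y, ‖conjSchwartz ψ y‖ ^ 2 = I := by
      simp [conjSchwartz_apply, hI]
    rw [h4, ← hI]
    -- The third occurrence is the bare `I`; the first two are under square roots.
    nth_rewrite 3 [← Real.mul_self_sqrt hI0]
    ring
  have hint : Integrable (fun w => ‖X w‖ ^ 2) P := hXL.integrable_norm_pow (by norm_num)
  have hmain : ∫ w, ‖X w‖ ^ 2 ∂P ≤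
      2 * (C * √(volume.real K) + (G * √(volume.real K)) ^ 2) * I := by
    have h1 : ∫ w, ‖X w‖ ^ 2 ∂P ≤ ∫ w, (2 * ‖X w - e‖ ^ 2 + 2 * ‖e‖ ^ 2) ∂P := by
      refine integral_mono hint (((hXe.integrable_norm_pow (by norm_num)).const_mul 2).add
        (integrable_const _)) fun w => ?_
      have h5 : ‖X w‖ ≤ ‖X w - e‖ + ‖e‖ := by
        simpa using norm_add_le (X w - e) e
      have h6 := norm_nonneg (X w)
      dsimp only
      nlinarith [sq_nonneg (‖X w - e‖ - ‖e‖), norm_nonneg (X w - e), norm_nonneg e]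
    rw [integral_add ((hXe.integrable_norm_pow (by norm_num)).const_mul 2) (integrable_const _),
      integral_const_mul, integral_const] at h1
    have h7 : ‖e‖ ^ 2 ≤ (G * √(volume.real K)) ^ 2 * I := by
      calc ‖e‖ ^ 2 ≤ (G * (√(volume.real K) * √I)) ^ 2 :=
            pow_le_pow_left₀ (norm_nonneg _) he_le 2
        _ = (G * √(volume.real K)) ^ 2 * √I ^ 2 := by ring
        _ = _ := by rw [Real.sq_sqrt hI0]
    simp only [probReal_univ, one_smul] at h1
    linarith
  rw [← ofReal_integral_sq_norm hXL]
  exact ENNReal.ofReal_le_ofReal hmain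

/-! ### The outgoing kernel in weighted `L²` -/

theorem norm_outgoingKernel (k : ℝ) (x y : RSpace 3) :
    ‖outgoingKernel k x y‖ = (4 * Real.pi * ‖x - y‖)⁻¹ := by
  have h : ‖Complex.exp (Complex.I * k * ‖x - y‖)‖ = 1 := by
    rw [Complex.norm_exp]
    simp
  rw [outgoingKernel, norm_div, h, one_div, norm_mul, norm_mul]
  simp [Real.pi_pos.le, abs_of_nonneg]

theorem norm_outgoingKernel_le (k : ℝ) (x y : RSpace 3) :
    ‖outgoingKernel k x y‖ ≤ ‖x - y‖⁻¹ := by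
  rw [norm_outgoingKernel, mul_inv]
  refine mul_le_of_le_one_left (by positivity) (inv_le_one_of_one_le₀ ?_)
  nlinarith [Real.pi_gt_three]

theorem measurable_outgoingKernel_right (k : ℝ) (x : RSpace 3) :
    Measurable (outgoingKernel k x) := by
  unfold outgoingKernel
  fun_prop

/-- In polar coordinates the factor $t^2$ cancels $|z|^{-2}$ and leaves $(1+t^2)^{-s}$ on the
half-line. This is where the threshold $-1/2$ comes from. -/
theorem integrable_inv_sq_norm_mul_rpow {s : ℝ} (hs : 1 / 2 < s) :
    Integrable (fun z : RSpace 3 => (‖z‖⁻¹) ^ 2 * (1 + ‖z‖ ^ 2) ^ (-s)) volume := by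
  rw [integrable_fun_norm_addHaar (μ := volume)
    (f := fun t : ℝ => (t⁻¹) ^ 2 * (1 + t ^ 2) ^ (-s))]
  have h := (integrable_rpow_neg_one_add_norm_sq (E := ℝ) (μ := volume) (r := 2 * s)
    (by simp; linarith)).integrableOn (s := Set.Ioi 0)
  refine h.congr_fun (fun t ht => ?_) measurableSet_Ioi
  have ht0 : t ≠ 0 := (Set.mem_Ioi.mp ht).ne'
  have h1 : -(2 * s) / 2 = -s := by ring
  simp only [finrank_euclideanSpace, Fintype.card_fin, smul_eq_mul, Real.norm_eq_abs, sq_abs, h1]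
  field_simp

/-- A Peetre-type inequality, used to recentre the weight at the singularity $y$ of the kernel. -/
theorem rpow_neg_one_add_sq_norm_le {E : Type*} [NormedAddCommGroup E] {s R : ℝ} (hs : 0 ≤ s)
    {x y : E} (hy : ‖y‖ ≤ R) :
    (1 + ‖x‖ ^ 2) ^ (-s) ≤ (2 * (1 + R ^ 2)) ^ s * (1 + ‖y - x‖ ^ 2) ^ (-s) := by
  have h1 : 1 + ‖y - x‖ ^ 2 ≤ 2 * (1 + R ^ 2) * (1 + ‖x‖ ^ 2) := by
    have h2 : ‖y - x‖ ≤ R + ‖x‖ := (norm_sub_le y x).trans (by gcongr)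
    have h3 : ‖y - x‖ ^ 2 ≤ (R + ‖x‖) ^ 2 := pow_le_pow_left₀ (norm_nonneg _) h2 2
    nlinarith [sq_nonneg (R - ‖x‖), sq_nonneg (R * ‖x‖)]
  have h4 : (1 + ‖y - x‖ ^ 2) ^ s ≤ (2 * (1 + R ^ 2)) ^ s * (1 + ‖x‖ ^ 2) ^ s := by
    rw [← Real.mul_rpow (by positivity) (by positivity)]
    exact Real.rpow_le_rpow (by positivity) h1 hs
  rw [Real.rpow_neg (by positivity), Real.rpow_neg (by positivity)]
  have hx : 0 < (1 + ‖x‖ ^ 2) ^ s := by positivity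
  have hyx : 0 < (1 + ‖y - x‖ ^ 2) ^ s := by positivity
  rw [← div_eq_mul_inv, inv_eq_one_div, div_le_div_iff₀ hx hyx]
  simpa using h4

/-- The outgoing kernel is in `L²_{-s}` for `s > 1/2`, locally uniformly in its first variable. -/
theorem exists_integral_sq_norm_outgoingKernel_le (k R : ℝ) {s : ℝ} (hs : 1 / 2 < s) :
    ∃ M : ℝ, 0 ≤ M ∧ ∀ y : RSpace 3, ‖y‖ ≤ R →
      Integrable (fun x => ‖outgoingKernel k y x‖ ^ 2 * (1 + ‖x‖ ^ 2) ^ (-s)) volume ∧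
      ∫ x, ‖outgoingKernel k y x‖ ^ 2 * (1 + ‖x‖ ^ 2) ^ (-s) ≤ M := by
  -- A translate of `H` dominates the integrand, and its integral does not depend on $y$; hence the
  -- uniform bound.
  set H : RSpace 3 → ℝ := fun z => (‖z‖⁻¹) ^ 2 * (1 + ‖z‖ ^ 2) ^ (-s) with hH
  have hHi : Integrable H volume := integrable_inv_sq_norm_mul_rpow hs
  refine ⟨(2 * (1 + R ^ 2)) ^ s * ∫ z, H z, mul_nonneg (by positivity)
    (integral_nonneg fun z => by positivity), fun y hy => ?_⟩
  have hdom : Integrable (fun x => (2 * (1 + R ^ 2)) ^ s * H (y - x)) volume :=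
    (hHi.comp_sub_left y).const_mul _
  have hle : ∀ x : RSpace 3, ‖outgoingKernel k y x‖ ^ 2 * (1 + ‖x‖ ^ 2) ^ (-s) ≤
      (2 * (1 + R ^ 2)) ^ s * H (y - x) := by
    intro x
    calc ‖outgoingKernel k y x‖ ^ 2 * (1 + ‖x‖ ^ 2) ^ (-s)
        ≤ (‖y - x‖⁻¹) ^ 2 * ((2 * (1 + R ^ 2)) ^ s * (1 + ‖y - x‖ ^ 2) ^ (-s)) := by
          gcongr
          · exact norm_outgoingKernel_le k y x
          · exact rpow_neg_one_add_sq_norm_le (by linarith) hy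
      _ = _ := by simp only [hH]; ring
  have hmeas : Measurable (fun x => ‖outgoingKernel k y x‖ ^ 2 * (1 + ‖x‖ ^ 2) ^ (-s)) :=
    ((measurable_outgoingKernel_right k y).norm.pow_const 2).mul (by fun_prop)
  have hint : Integrable (fun x => ‖outgoingKernel k y x‖ ^ 2 * (1 + ‖x‖ ^ 2) ^ (-s)) volume :=
    hdom.mono' hmeas.aestronglyMeasurable (Eventually.of_forall fun x => by
      rw [Real.norm_of_nonneg (by positivity)]
      exact hle x)
  refine ⟨hint, (integral_mono hint hdom hle).trans (le_of_eq ?_)⟩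
  rw [integral_const_mul, integral_sub_left_eq_self H volume y]

/-! ### The cut-off resolvent as a linear map -/

theorem resolvent_eq_convolution (k : ℝ) (φ : RSpace 3 → ℂ) :
    resolvent k φ = convolution φ (fun x => outgoingKernel k x 0)
      (ContinuousLinearMap.mul ℝ ℂ) volume := by
  ext x
  simp only [resolvent, convolution, ContinuousLinearMap.mul_apply']
  refine integral_congr_ae (Eventually.of_forall fun y => ?_)
  simp [outgoingKernel, mul_comm]

theorem integrable_outgoingKernel_mul (k : ℝ) {φ : RSpace 3 → ℂ} (h₁ : Continuous φ)
    (h₂ : HasCompactSupport φ) (x : RSpace 3) :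
    Integrable (fun y => outgoingKernel k x y * φ y) volume := by
  have h := h₂.convolutionExists_left (ContinuousLinearMap.mul ℝ ℂ) h₁
    (locallyIntegrable_outgoingKernel k) x
  refine h.congr (Eventually.of_forall fun y => ?_)
  simp [outgoingKernel, mul_comm]

/-- The smooth compactly supported functions, as a subspace of the Schwartz space. -/
def compactSchwartz : Submodule ℂ 𝓢(RSpace 3, ℂ) where
  carrier := {φ | HasCompactSupport φ}
  add_mem' := fun h₁ h₂ => HasCompactSupport.add h₁ h₂
  zero_mem' := HasCompactSupport.zero
  smul_mem' := fun c _ h => HasCompactSupport.smul_left (f := fun _ => c) h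

/-- An element of `compactSchwartz` as a test function. -/
def compactSchwartz.toTestFn (φ : compactSchwartz) : TestFn where
  toFun := φ.1
  smooth := φ.1.smooth ⊤
  compactSupport := φ.2

/-- A test function as an element of `compactSchwartz`. -/
def TestFn.toCompactSchwartz (φ : TestFn) : compactSchwartz :=
  ⟨φ.compactSupport.toSchwartzMap φ.smooth, φ.compactSupport⟩

theorem cutoffResolvent_apply (k : ℝ) (χ φ : TestFn) (x : RSpace 3) :
    cutoffResolvent k χ φ x = χ.toFun x * resolvent k φ.toFun x := rfl

/-- The linear map `φ ↦ χ · R_k φ`. -/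
def cutoffResolventLM (k : ℝ) (χ : TestFn) : compactSchwartz →ₗ[ℂ] 𝓢(RSpace 3, ℂ) where
  toFun φ := cutoffResolvent k χ (compactSchwartz.toTestFn φ)
  map_add' φ ψ := by
    ext x
    simp only [add_apply, cutoffResolvent_apply]
    rw [← mul_add]
    congr 1
    simp only [resolvent, compactSchwartz.toTestFn]
    rw [← integral_add (integrable_outgoingKernel_mul k φ.1.continuous φ.2 x)
      (integrable_outgoingKernel_mul k ψ.1.continuous ψ.2 x)]
    simp [mul_add]
  map_smul' c φ := by
    ext x
    simp only [smul_apply, cutoffResolvent_apply, RingHom.id_apply, smul_eq_mul]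
    rw [mul_left_comm]
    congr 1
    simp only [resolvent, compactSchwartz.toTestFn]
    rw [← integral_const_mul]
    simp [mul_left_comm]

theorem cutoffResolventLM_apply (k : ℝ) (χ : TestFn) (φ : compactSchwartz) (x : RSpace 3) :
    cutoffResolventLM k χ φ x = χ.toFun x * resolvent k φ.1 x := rfl

/-! ### The weighted embedding into `L²` -/

theorem hasTemperateGrowth_weight (δ : ℝ) :
    Function.HasTemperateGrowth (fun x : RSpace 3 => (((1 + ‖x‖ ^ 2) ^ δ : ℝ) : ℂ)) :=
  Function.HasTemperateGrowth.comp (g := Complex.ofRealCLM)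
    Complex.ofRealCLM.hasTemperateGrowth
    (Function.hasTemperateGrowth_one_add_norm_sq_rpow (RSpace 3) δ)

/-- The map `φ ↦ (1 + |x|²)^δ φ` from the Schwartz space to `L²`. -/
def weightedToL2 (δ : ℝ) : 𝓢(RSpace 3, ℂ) →L[ℂ] Lp ℂ 2 (volume : Measure (RSpace 3)) :=
  (SchwartzMap.toLpCLM ℂ ℂ 2 volume).comp
    (SchwartzMap.smulLeftCLM ℂ (fun x : RSpace 3 => (((1 + ‖x‖ ^ 2) ^ δ : ℝ) : ℂ)))

theorem coeFn_weightedToL2 (δ : ℝ) (φ : 𝓢(RSpace 3, ℂ)) :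
    weightedToL2 δ φ =ᵐ[volume] fun x => (((1 + ‖x‖ ^ 2) ^ δ : ℝ) : ℂ) * φ x := by
  refine (SchwartzMap.coeFn_toLp _ 2 volume).trans (Eventually.of_forall fun x => ?_)
  change SchwartzMap.smulLeftCLM ℂ (fun x : RSpace 3 => (((1 + ‖x‖ ^ 2) ^ δ : ℝ) : ℂ)) φ x = _
  rw [SchwartzMap.smulLeftCLM_apply_apply (hasTemperateGrowth_weight δ), smul_eq_mul]

/-- Needed to pull span relations in $L^2$ back to test functions after Gram–Schmidt. -/
theorem weightedToL2_injective (δ : ℝ) : Function.Injective (weightedToL2 δ) := by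
  rw [injective_iff_map_eq_zero]
  intro φ hφ
  have h1 := SchwartzMap.injective_toLp (F := ℂ) 2 (volume : Measure (RSpace 3))
    (hφ.trans (map_zero (SchwartzMap.toLpCLM ℂ ℂ 2 volume)).symm)
  ext x
  have h2 : SchwartzMap.smulLeftCLM ℂ (fun x : RSpace 3 => (((1 + ‖x‖ ^ 2) ^ δ : ℝ) : ℂ)) φ x = 0 :=
    DFunLike.congr_fun h1 x
  rw [SchwartzMap.smulLeftCLM_apply_apply (hasTemperateGrowth_weight δ)] at h2
  have h3 : (((1 + ‖x‖ ^ 2) ^ δ : ℝ) : ℂ) ≠ 0 := by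
    have : (0 : ℝ) < (1 + ‖x‖ ^ 2) ^ δ := by positivity
    exact_mod_cast this.ne'
  simpa [h3] using h2

/-! ### The Hilbert–Schmidt property of the cut-off resolvent -/

/-- Bessel's inequality for the outgoing kernel. -/
theorem exists_tsum_sq_enorm_resolvent_le (k R : ℝ) {δ : ℝ} (hδ : 1 / 4 < δ) :
    ∃ M : ℝ, 0 ≤ M ∧ ∀ {ι : Type} (v : ι → 𝓢(RSpace 3, ℂ)),
      Orthonormal ℂ (fun i => weightedToL2 δ (v i)) → ∀ y : RSpace 3, ‖y‖ ≤ R →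
      ∑' i, ‖resolvent k (v i) y‖ₑ ^ 2 ≤ ENNReal.ofReal M := by
  obtain ⟨M, hM0, hM⟩ := exists_integral_sq_norm_outgoingKernel_le k R
    (s := 2 * δ) (by linarith)
  refine ⟨M, hM0, fun {ι} v hv y hy => ?_⟩
  obtain ⟨hint, hle⟩ := hM y hy
  -- The Riesz vector of $J\varphi\mapsto(\mathcal R_k\varphi)(y)$, conjugated because the inner
  -- product is conjugate linear in its first slot. Its squared norm carries the weight exponent
  -- $-2\delta$, whence $\delta>1/4$.
  set κ : RSpace 3 → ℂ :=
    fun x => conj (outgoingKernel k y x) * (((1 + ‖x‖ ^ 2) ^ (-δ) : ℝ) : ℂ) with hκ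
  have hκ_sq : ∀ x, ‖κ x‖ ^ 2 = ‖outgoingKernel k y x‖ ^ 2 * (1 + ‖x‖ ^ 2) ^ (-(2 * δ)) := by
    intro x
    have h0 : (0 : ℝ) ≤ 1 + ‖x‖ ^ 2 := by positivity
    simp only [hκ, norm_mul, RCLike.norm_conj, Complex.norm_real, mul_pow]
    rw [Real.norm_of_nonneg (by positivity), ← Real.rpow_natCast ((1 + ‖x‖ ^ 2) ^ (-δ)),
      ← Real.rpow_mul h0]
    congr 2
    push_cast
    ring
  have hκ_meas : AEStronglyMeasurable κ volume := by
    refine ((Complex.continuous_conj.measurable.comp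
      (measurable_outgoingKernel_right k y)).mul ?_).aestronglyMeasurable
    fun_prop
  have hκL : MemLp κ 2 volume := by
    rw [memLp_two_iff_integrable_sq_norm hκ_meas]
    simpa only [hκ_sq] using hint
  have hinner : ∀ i, inner ℂ (hκL.toLp κ) (weightedToL2 δ (v i)) = resolvent k (v i) y := by
    intro i
    rw [L2.inner_def, resolvent]
    refine integral_congr_ae ?_
    filter_upwards [hκL.coeFn_toLp, coeFn_weightedToL2 δ (v i)] with x hx1 hx2
    rw [hx1, hx2]
    have h0 : (0 : ℝ) < 1 + ‖x‖ ^ 2 := by positivity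
    have h1 : (((1 + ‖x‖ ^ 2) ^ (-δ) : ℝ) : ℂ) * (((1 + ‖x‖ ^ 2) ^ δ : ℝ) : ℂ) = 1 := by
      rw [← Complex.ofReal_mul, ← Real.rpow_add h0]
      simp
    simp only [hκ, RCLike.inner_apply, map_mul, Complex.conj_conj, Complex.conj_ofReal]
    linear_combination (outgoingKernel k y x * v i x) * h1
  have hnorm : ‖hκL.toLp κ‖ ^ 2 ≤ M := by
    rw [← @inner_self_eq_norm_sq ℂ, L2.inner_def]
    refine (le_of_eq ?_).trans hle
    have h1 : ∀ᵐ x ∂(volume : Measure (RSpace 3)),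
        inner ℂ (hκL.toLp κ x) (hκL.toLp κ x) =
          ((‖outgoingKernel k y x‖ ^ 2 * (1 + ‖x‖ ^ 2) ^ (-(2 * δ)) : ℝ) : ℂ) := by
      filter_upwards [hκL.coeFn_toLp] with x hx
      rw [hx, inner_self_eq_norm_sq_to_K, ← hκ_sq x]
      simp
    rw [integral_congr_ae h1, integral_complex_ofReal]
    simp
  have hsq : ∀ i, ‖resolvent k (v i) y‖ₑ ^ 2 =
      ENNReal.ofReal (‖inner ℂ (weightedToL2 δ (v i)) (hκL.toLp κ)‖ ^ 2) := by
    intro i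
    rw [norm_inner_symm, hinner i, ENNReal.ofReal_pow (norm_nonneg _), ofReal_norm]
  simp only [hsq]
  rw [← ENNReal.ofReal_tsum_of_nonneg (fun i => by positivity) (hv.inner_products_summable _)]
  exact ENNReal.ofReal_le_ofReal ((hv.tsum_inner_products_le _).trans hnorm)

/-- The operator `φ ↦ χ · R_k φ` from `L²_δ` to `L²` is a Hilbert–Schmidt operator. -/
theorem exists_tsum_lintegral_cutoffResolventLM_le (k : ℝ) (χ : TestFn) {δ : ℝ}
    (hδ : 1 / 4 < δ) :
    ∃ M : ENNReal, M ≠ ⊤ ∧ ∀ {ι : Type} [Countable ι] (v : ι → compactSchwartz),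
      Orthonormal ℂ (fun i => weightedToL2 δ (v i)) →
      ∑' i, ∫⁻ x, ‖cutoffResolventLM k χ (v i) x‖ₑ ^ 2 ≤ M := by
  obtain ⟨R, hR⟩ := χ.compactSupport.isCompact.isBounded.subset_closedBall 0
  obtain ⟨M, -, hM⟩ := exists_tsum_sq_enorm_resolvent_le k R hδ
  have hχL : MemLp χ.toFun 2 volume :=
    χ.smooth.continuous.memLp_of_hasCompactSupport χ.compactSupport
  refine ⟨(∫⁻ x, ‖χ.toFun x‖ₑ ^ 2) * ENNReal.ofReal M, ?_, fun {ι} _ v hv => ?_⟩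
  · refine ENNReal.mul_ne_top ?_ ENNReal.ofReal_ne_top
    rw [← ofReal_integral_sq_norm hχL]
    exact ENNReal.ofReal_ne_top
  -- Tonelli moves the sum under the integral, so Bessel applies pointwise on the support of $\chi$.
  · rw [← lintegral_tsum fun i =>
      ((cutoffResolventLM k χ (v i)).continuous.enorm.measurable.pow_const 2).aemeasurable,
      ← lintegral_mul_const _ (χ.smooth.continuous.enorm.measurable.pow_const 2)]
    refine lintegral_mono fun x => ?_
    simp only [cutoffResolventLM_apply, enorm_mul, mul_pow]
    rw [ENNReal.tsum_mul_left]
    by_cases hx : x ∈ tsupport χ.toFun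
    · gcongr
      exact hM (fun i => (v i).1) hv x (by simpa using hR hx)
    · simp [image_eq_zero_of_notMem_tsupport hx]

/-! ### Continuity of the cut-off resolvent -/

/-- For $|x|\le R$ and $t$ in the support of $\varphi$, the point $x-t$ lies in the ball of radius
$N+R$, where $g$ is integrable. -/
theorem norm_convolution_le_of_tsupport_subset {E F : Type} [NormedAddCommGroup E]
    [NormedSpace ℝ E] [NormedAddCommGroup F] [NormedSpace ℝ F] (L : E →L[ℝ] ℂ →L[ℝ] F)
    {φ : RSpace 3 → E} {g : RSpace 3 → ℂ} (hg : LocallyIntegrable g volume) {N R S : ℝ}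
    (hφ : tsupport φ ⊆ Metric.closedBall 0 N) (hS : ∀ t, ‖φ t‖ ≤ S) {x : RSpace 3}
    (hx : ‖x‖ ≤ R) :
    ‖convolution φ g L volume x‖ ≤
      ‖L‖ * S * ∫ z in Metric.closedBall (0 : RSpace 3) (N + R), ‖g z‖ := by
  have hS0 : 0 ≤ S := (norm_nonneg _).trans (hS 0)
  set K : Set (RSpace 3) := Metric.closedBall 0 (N + R) with hK
  have hKm : MeasurableSet K := Metric.isClosed_closedBall.measurableSet
  have hgi : Integrable (K.indicator fun z => ‖g z‖) volume :=
    (integrable_indicator_iff hKm).mpr (hg.integrableOn_isCompact (isCompact_closedBall _ _)).norm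
  rw [← integral_indicator hKm, ← integral_sub_left_eq_self (K.indicator fun z => ‖g z‖) volume x,
    ← integral_const_mul]
  refine norm_integral_le_of_norm_le ((hgi.comp_sub_left x).const_mul _)
    (Eventually.of_forall fun t => ?_)
  by_cases ht : t ∈ tsupport φ
  · have ht' : ‖t‖ ≤ N := by simpa using hφ ht
    have hxt : x - t ∈ K := by
      rw [hK, mem_closedBall_zero_iff]
      exact (norm_sub_le x t).trans (by linarith)
    rw [Set.indicator_of_mem hxt]
    exact (L.le_opNorm₂ _ _).trans (by gcongr; exact hS t)
  · rw [image_eq_zero_of_notMem_tsupport ht]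
    simp only [map_zero, zero_apply, norm_zero]
    exact mul_nonneg (by positivity) (Set.indicator_nonneg (fun _ _ => norm_nonneg _) _)

/-- All derivatives fall on $\varphi$. Each one changes the target spaces and replaces `L` by
`L.precompL`, of no larger norm, so the spaces are quantified inside the induction. -/
theorem norm_iteratedFDeriv_convolution_le (j : ℕ) : ∀ {E F : Type} [NormedAddCommGroup E]
    [NormedSpace ℝ E] [NormedAddCommGroup F] [NormedSpace ℝ F] (L : E →L[ℝ] ℂ →L[ℝ] F)
    {φ : RSpace 3 → E} {g : RSpace 3 → ℂ}, ContDiff ℝ ∞ φ → HasCompactSupport φ →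
    LocallyIntegrable g volume → ∀ {N R S : ℝ}, tsupport φ ⊆ Metric.closedBall 0 N →
    (∀ t, ‖iteratedFDeriv ℝ j φ t‖ ≤ S) → ∀ {x : RSpace 3}, ‖x‖ ≤ R →
    ‖iteratedFDeriv ℝ j (convolution φ g L volume) x‖ ≤
      ‖L‖ * S * ∫ z in Metric.closedBall (0 : RSpace 3) (N + R), ‖g z‖ := by
  induction j with
  | zero =>
    intro E F _ _ _ _ L φ g _ _ hg N R S hN hS x hx
    rw [norm_iteratedFDeriv_zero]
    exact norm_convolution_le_of_tsupport_subset L hg hN (by simpa using hS) hx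
  | succ j ih =>
    intro E F _ _ _ _ L φ g hφ hφc hg N R S hN hS x hx
    have hS0 : 0 ≤ S := (norm_nonneg _).trans (hS 0)
    have hfd : fderiv ℝ (convolution φ g L volume) =
        convolution (fderiv ℝ φ) g (L.precompL (RSpace 3)) volume := by
      ext1 y
      exact (hφc.hasFDerivAt_convolution_left L (hφ.of_le (by exact_mod_cast le_top)) hg y).fderiv
    rw [← norm_iteratedFDeriv_fderiv, hfd]
    refine (ih (L.precompL (RSpace 3)) (hφ.fderiv_right (by simp)) (hφc.fderiv ℝ) hg
      ((tsupport_fderiv_subset ℝ).trans hN) (S := S) (fun t => ?_) hx).trans ?_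
    · rw [norm_iteratedFDeriv_fderiv]
      exact hS t
    · gcongr
      exact L.norm_precompL_le (RSpace 3)

theorem exists_seminorm_cutoffResolventLM_le (k : ℝ) (χ : TestFn) (N : ℝ) (l n : ℕ) :
    ∃ C : ℕ → ℝ, ∀ φ : compactSchwartz, tsupport φ.1 ⊆ Metric.closedBall 0 N →
      SchwartzMap.seminorm ℂ l n (cutoffResolventLM k χ φ) ≤
        ∑ i ∈ Finset.range (n + 1), C i * SchwartzMap.seminorm ℂ 0 (n - i) φ.1 := by
  obtain ⟨R, hR⟩ := χ.compactSupport.isCompact.isBounded.subset_closedBall 0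
  set I : ℝ := ∫ z in Metric.closedBall (0 : RSpace 3) (N + R), ‖outgoingKernel k z 0‖ with hI
  have hI0 : 0 ≤ I := integral_nonneg fun _ => norm_nonneg _
  set X : 𝓢(RSpace 3, ℂ) := (TestFn.toCompactSchwartz χ).1 with hX
  refine ⟨fun i => |R| ^ l * (n.choose i * SchwartzMap.seminorm ℂ 0 i X *
    (‖ContinuousLinearMap.mul ℝ ℂ‖ * I)), fun φ hφ => ?_⟩
  have hnn : ∀ i, 0 ≤ |R| ^ l * (n.choose i * SchwartzMap.seminorm ℂ 0 i X *
    (‖ContinuousLinearMap.mul ℝ ℂ‖ * I)) := fun i => by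
      have := apply_nonneg (SchwartzMap.seminorm ℂ 0 i) X
      positivity
  refine SchwartzMap.seminorm_le_bound ℂ l n _ (Finset.sum_nonneg fun i _ =>
    mul_nonneg (hnn i) (apply_nonneg _ _)) fun x => ?_
  by_cases hx : x ∈ tsupport χ.toFun
  · have hxR : ‖x‖ ≤ R := by simpa using hR hx
    have h1 := norm_iteratedFDeriv_mul_le (N := ∞) χ.smooth
      (contDiff_resolvent k (φ.1.smooth ⊤) φ.2) x (n := n) (by exact_mod_cast le_top)
    calc ‖x‖ ^ l * ‖iteratedFDeriv ℝ n (cutoffResolventLM k χ φ) x‖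
        ≤ |R| ^ l * ∑ i ∈ Finset.range (n + 1), (n.choose i : ℝ) *
            ‖iteratedFDeriv ℝ i χ.toFun x‖ * ‖iteratedFDeriv ℝ (n - i) (resolvent k φ.1) x‖ := by
          gcongr
          · exact hxR.trans (le_abs_self R)
          · exact h1
      _ ≤ |R| ^ l * ∑ i ∈ Finset.range (n + 1), (n.choose i : ℝ) *
            SchwartzMap.seminorm ℂ 0 i X *
              (‖ContinuousLinearMap.mul ℝ ℂ‖ * SchwartzMap.seminorm ℂ 0 (n - i) φ.1 * I) := by
          gcongr with i _
          · exact SchwartzMap.norm_iteratedFDeriv_le_seminorm ℂ X i x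
          · rw [resolvent_eq_convolution]
            exact norm_iteratedFDeriv_convolution_le (n - i) _ (φ.1.smooth ⊤) φ.2
              (locallyIntegrable_outgoingKernel k) hφ
              (SchwartzMap.norm_iteratedFDeriv_le_seminorm ℂ φ.1 (n - i)) hxR
      _ = _ := by
          rw [Finset.mul_sum]
          exact Finset.sum_congr rfl fun i _ => by ring
  · have h0 : iteratedFDeriv ℝ n (cutoffResolventLM k χ φ) x = 0 := by
      by_contra hne
      refine hx ?_
      have h2 : x ∈ tsupport (cutoffResolventLM k χ φ) :=
        support_iteratedFDeriv_subset n hne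
      exact tsupport_mul_subset_left (f := χ.toFun) (g := resolvent k φ.1) h2
    rw [h0, norm_zero, mul_zero]
    exact Finset.sum_nonneg fun i _ => mul_nonneg (hnn i) (apply_nonneg _ _)

/-- The seminorm bounds hold for supports in a fixed ball, so the continuity is stated along
sequences with a common support bound. -/
theorem tendsto_cutoffResolventLM (k : ℝ) (χ : TestFn) {N : ℝ} {u : ℕ → compactSchwartz}
    {φ : compactSchwartz} (hu : ∀ j, tsupport (u j).1 ⊆ Metric.closedBall 0 N)
    (hφ : tsupport φ.1 ⊆ Metric.closedBall 0 N)
    (h : Tendsto (fun j => (u j).1) atTop (𝓝 φ.1)) :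
    Tendsto (fun j => cutoffResolventLM k χ (u j)) atTop (𝓝 (cutoffResolventLM k χ φ)) := by
  rw [(schwartz_withSeminorms ℂ (RSpace 3) ℂ).tendsto_nhds]
  rintro ⟨l, n⟩ ε hε
  obtain ⟨C, hC⟩ := exists_seminorm_cutoffResolventLM_le k χ N l n
  have hlim : Tendsto (fun j => ∑ i ∈ Finset.range (n + 1),
      C i * SchwartzMap.seminorm ℂ 0 (n - i) ((u j).1 - φ.1)) atTop (𝓝 0) := by
    have h0 : (0 : ℝ) = ∑ i ∈ Finset.range (n + 1),
        C i * SchwartzMap.seminorm ℂ 0 (n - i) (φ.1 - φ.1) := by simp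
    rw [h0]
    refine tendsto_finsetSum _ fun i _ => Tendsto.const_mul _ ?_
    have hcont : Continuous (SchwartzMap.seminorm ℂ 0 (n - i) : 𝓢(RSpace 3, ℂ) → ℝ) :=
      (schwartz_withSeminorms ℂ (RSpace 3) ℂ).continuous_seminorm (0, n - i)
    exact (hcont.tendsto _).comp (h.sub_const φ.1)
  filter_upwards [hlim.eventually_lt_const hε] with j hj
  rw [SchwartzMap.schwartzSeminormFamily_apply, ← map_sub]
  refine (hC (u j - φ) ?_).trans_lt hj
  exact (tsupport_sub (u j).1 φ.1).trans (Set.union_subset (hu j) hφ)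

/-! ### Separability of the space of test functions -/

instance secondCountableTopology_continuousMultilinearMap {n i : ℕ} :
    SecondCountableTopology (RSpace n [×i]→L[ℝ] ℂ) := by
  have : FiniteDimensional ℝ (RSpace n [×i]→L[ℝ] ℂ) :=
    FiniteDimensional.of_injective
      { toFun := fun L : RSpace n [×i]→L[ℝ] ℂ => L.toMultilinearMap
        map_add' := fun _ _ => rfl
        map_smul' := fun _ _ => rfl }
      ContinuousMultilinearMap.toMultilinearMap_injective
  have : ProperSpace (RSpace n [×i]→L[ℝ] ℂ) := FiniteDimensional.proper ℝ _
  infer_instance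

/-- All the derivatives of a Schwartz function. -/
def schwartzJet (φ : 𝓢(RSpace 3, ℂ)) (i : ℕ) : C(RSpace 3, RSpace 3 [×i]→L[ℝ] ℂ) :=
  ⟨iteratedFDeriv ℝ i φ, (φ.smooth ⊤).continuous_iteratedFDeriv (by exact_mod_cast le_top)⟩

/-- On a fixed ball the factors $|x|^l$ are bounded, so locally uniform convergence of every
derivative suffices. -/
theorem tendsto_of_tendsto_schwartzJet {N : ℝ} {u : ℕ → 𝓢(RSpace 3, ℂ)} {φ : 𝓢(RSpace 3, ℂ)}
    (hu : ∀ j, tsupport (u j) ⊆ Metric.closedBall 0 N) (hφ : tsupport φ ⊆ Metric.closedBall 0 N)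
    (h : Tendsto (fun j => schwartzJet (u j)) atTop (𝓝 (schwartzJet φ))) :
    Tendsto u atTop (𝓝 φ) := by
  rw [(schwartz_withSeminorms ℂ (RSpace 3) ℂ).tendsto_nhds]
  rintro ⟨l, n⟩ ε hε
  have h1 := ContinuousMap.tendsto_iff_forall_isCompact_tendstoUniformlyOn.mp
    ((tendsto_pi_nhds.mp h) n) _ (isCompact_closedBall (0 : RSpace 3) N)
  rw [Metric.tendstoUniformlyOn_iff] at h1
  have hN : 0 < |N| ^ l + 1 := by positivity
  filter_upwards [h1 (ε / 2 / (|N| ^ l + 1)) (by positivity)] with j hj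
  rw [SchwartzMap.schwartzSeminormFamily_apply]
  refine lt_of_le_of_lt (SchwartzMap.seminorm_le_bound ℂ l n _ (M := ε / 2) (by positivity)
    fun x => ?_) (half_lt_self hε)
  by_cases hx : x ∈ Metric.closedBall (0 : RSpace 3) N
  · have hxN : ‖x‖ ≤ |N| := (mem_closedBall_zero_iff.mp hx).trans (le_abs_self N)
    have h2 : iteratedFDeriv ℝ n (u j - φ) x = schwartzJet (u j) n x - schwartzJet φ n x :=
      iteratedFDeriv_sub_apply ((u j).contDiffAt ⊤ |>.of_le (by exact_mod_cast le_top))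
        (φ.contDiffAt ⊤ |>.of_le (by exact_mod_cast le_top))
    have h3 := hj x hx
    rw [dist_comm, dist_eq_norm, ← h2] at h3
    calc ‖x‖ ^ l * ‖iteratedFDeriv ℝ n (u j - φ) x‖
        ≤ (|N| ^ l + 1) * (ε / 2 / (|N| ^ l + 1)) := by
          gcongr
          exact (pow_le_pow_left₀ (norm_nonneg x) hxN l).trans (by linarith)
      _ = ε / 2 := by field_simp
  · have h0 : iteratedFDeriv ℝ n (u j - φ) x = 0 := by
      by_contra hne
      exact hx (((tsupport_sub (u j) φ).trans (Set.union_subset (hu j) hφ))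
        (support_iteratedFDeriv_subset n hne))
    rw [h0, norm_zero, mul_zero]
    positivity

/-- The jet map induces a topology from a countable product of second countable spaces of continuous
functions. Second countability passes to the subspace supported in the ball, so the approximants
keep that support. -/
theorem exists_countable_dense_tsupport_subset (N : ℝ) :
    ∃ S : Set compactSchwartz, S.Countable ∧ ∀ φ : compactSchwartz,
      tsupport φ.1 ⊆ Metric.closedBall 0 N → ∃ u : ℕ → compactSchwartz, (∀ j, u j ∈ S) ∧
        (∀ j, tsupport (u j).1 ⊆ Metric.closedBall 0 N) ∧
        Tendsto (fun j => (u j).1) atTop (𝓝 φ.1) := by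
  let V : Type := {φ : compactSchwartz // tsupport φ.1 ⊆ Metric.closedBall 0 N}
  let T : V → ∀ i, C(RSpace 3, RSpace 3 [×i]→L[ℝ] ℂ) := fun φ => schwartzJet φ.1.1
  let : TopologicalSpace V := TopologicalSpace.induced T inferInstance
  have : SecondCountableTopology V := TopologicalSpace.secondCountableTopology_induced _ _ T
  obtain ⟨S, hS, hSd⟩ := TopologicalSpace.exists_countable_dense V
  refine ⟨Subtype.val '' S, hS.image _, fun φ hφ => ?_⟩
  obtain ⟨u, huS, hu⟩ := mem_closure_iff_seq_limit.mp (hSd ⟨φ, hφ⟩)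
  refine ⟨fun j => (u j).1, fun j => ⟨u j, huS j, rfl⟩, fun j => (u j).2, ?_⟩
  refine tendsto_of_tendsto_schwartzJet (fun j => (u j).2) hφ ?_
  exact ((continuous_induced_dom (f := T)).tendsto _).comp hu

/-- There is a sequence of test functions which is dense in the space of test functions. -/
theorem exists_dense_seq_compactSchwartz :
    ∃ s : ℕ → compactSchwartz, ∀ φ : compactSchwartz, ∃ (N : ℝ) (u : ℕ → compactSchwartz),
      (∀ j, u j ∈ Set.range s) ∧ (∀ j, tsupport (u j).1 ⊆ Metric.closedBall 0 N) ∧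
      tsupport φ.1 ⊆ Metric.closedBall 0 N ∧ Tendsto (fun j => (u j).1) atTop (𝓝 φ.1) := by
  choose S hS hSd using fun N : ℕ => exists_countable_dense_tsupport_subset N
  have hne : (⋃ N, S N).Nonempty := by
    obtain ⟨u, hu, -⟩ := hSd 0 0 (by simp [tsupport])
    exact ⟨u 0, Set.mem_iUnion.mpr ⟨0, hu 0⟩⟩
  obtain ⟨s, hs⟩ := (Set.countable_iUnion hS).exists_eq_range hne
  refine ⟨s, fun φ => ?_⟩
  obtain ⟨R, hR⟩ := φ.2.isCompact.isBounded.subset_closedBall 0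
  obtain ⟨N, hN⟩ := exists_nat_ge R
  have hφ := hR.trans (Metric.closedBall_subset_closedBall hN)
  obtain ⟨u, huS, huN, hu⟩ := hSd N φ hφ
  exact ⟨N, u, fun j => hs ▸ Set.mem_iUnion.mpr ⟨N, huS j⟩, huN, hφ, hu⟩

/-! ### Orthonormal families and functionals -/

/-- Gram–Schmidt orthonormalisation along an injective linear map. -/
theorem exists_orthonormal_comp_span {V H : Type*} [AddCommGroup V] [Module ℂ V]
    [NormedAddCommGroup H] [InnerProductSpace ℂ H] (J : V →ₗ[ℂ] H) (hJ : Function.Injective J)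
    (s : ℕ → V) :
    ∃ (ι : Type) (_ : Countable ι) (v : ι → V), Orthonormal ℂ (fun i => J (v i)) ∧
      ∀ n, s n ∈ Submodule.span ℂ (Set.range v) := by
  set e : ℕ → H := InnerProductSpace.gramSchmidtNormed ℂ (fun n => J (s n)) with he
  have hspan : Submodule.span ℂ (Set.range e) =
      (Submodule.span ℂ (Set.range s)).map J := by
    rw [he, InnerProductSpace.span_gramSchmidtNormed_range, InnerProductSpace.span_gramSchmidt,
      Submodule.map_span, ← Set.range_comp]
    rfl
  have hlift : ∀ i, ∃ v, J v = e i := fun i => by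
    have h1 : e i ∈ (Submodule.span ℂ (Set.range s)).map J :=
      hspan ▸ Submodule.subset_span ⟨i, rfl⟩
    obtain ⟨v, -, hv⟩ := h1
    exact ⟨v, hv⟩
  choose v hv using hlift
  -- Gram–Schmidt returns zero at linearly dependent indices; these are discarded.
  refine ⟨{i : ℕ // e i ≠ 0}, inferInstance, fun i => v i, ?_, fun n => ?_⟩
  · simp only [hv]
    exact InnerProductSpace.gramSchmidtNormed_orthonormal' (𝕜 := ℂ) fun n => J (s n)
  · have h1 : Submodule.span ℂ (Set.range e) ≤
        (Submodule.span ℂ (Set.range fun i : {i : ℕ // e i ≠ 0} => v i)).map J := by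
      rw [Submodule.span_le]
      rintro _ ⟨i, rfl⟩
      by_cases hi : e i = 0
      · rw [hi]
        exact Submodule.zero_mem _
      · exact ⟨v i, Submodule.subset_span ⟨⟨i, hi⟩, rfl⟩, hv i⟩
    have h2 : J (s n) ∈ Submodule.span ℂ (Set.range e) :=
      hspan ▸ Submodule.mem_map_of_mem (Submodule.subset_span ⟨n, rfl⟩)
    obtain ⟨w, hw, hws⟩ := h1 h2
    exact hJ hws ▸ hw

/-- Riesz–Fischer: $h=\sum_i\overline{a_i}\,e_i$. -/
theorem Orthonormal.exists_inner_eq {ι H : Type*} [NormedAddCommGroup H] [InnerProductSpace ℂ H]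
    [CompleteSpace H] {e : ι → H} (he : Orthonormal ℂ e) {a : ι → ℂ}
    (ha : Summable fun i => ‖a i‖ ^ 2) : ∃ h : H, ∀ i, inner ℂ h (e i) = a i := by
  classical
  have hsum : Summable fun i => conj (a i) • e i := by
    have h1 := (he.orthogonalFamily.summable_iff_norm_sq_summable (fun i => conj (a i))).mpr
      (by simpa using ha)
    simpa using h1
  refine ⟨∑' i, conj (a i) • e i, fun i => ?_⟩
  have h2 : HasSum (fun j => inner ℂ (e i) (conj (a j) • e j))
      (inner ℂ (e i) (∑' j, conj (a j) • e j)) :=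
    (innerSL ℂ (e i)).hasSum hsum.hasSum
  have h3 : HasSum (fun j => inner ℂ (e i) (conj (a j) • e j)) (conj (a i)) := by
    have h4 : ∀ j, inner ℂ (e i) (conj (a j) • e j) = if j = i then conj (a i) else 0 := by
      intro j
      rw [inner_smul_right, orthonormal_iff_ite.mp he i j]
      by_cases hij : i = j
      · subst hij
        simp
      · simp [hij, Ne.symm hij]
    simp only [h4]
    exact hasSum_ite_eq i _
  rw [← inner_conj_symm, h2.unique h3, Complex.conj_conj]

/-! ### Distributions vanish off their support -/

/-- Finitely many open sets on which $f$ vanishes cover the support of $\psi$; a subordinate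
partition of unity splits $\psi$ into pieces killed by $f$. -/
theorem apply_eq_zero_of_disjoint_dsupport (f : 𝓢'(RSpace 3, ℂ)) (ψ : 𝓢(RSpace 3, ℂ))
    (hψ : HasCompactSupport ψ) (hd : tsupport ψ ⊆ (Distribution.dsupport f)ᶜ) : f ψ = 0 := by
  rw [Distribution.dsupport_compl_eq] at hd
  obtain ⟨t, ht⟩ := hψ.isCompact.elim_finite_subcover
    (fun a : {a | Distribution.IsVanishingOn f a ∧ IsOpen a} => (a : Set (RSpace 3)))
    (fun a => a.2.2) (by rwa [← Set.sUnion_eq_iUnion])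
  obtain ⟨ρ, hρ⟩ := SmoothPartitionOfUnity.exists_isSubordinate
    (modelWithCornersSelf ℝ (RSpace 3)) (isClosed_tsupport ψ) (fun a : t => (a.1 : Set (RSpace 3)))
    (fun a => a.1.2.2) (by
      intro x hx
      obtain ⟨a, ha, hxa⟩ := Set.mem_iUnion₂.mp (ht hx)
      exact Set.mem_iUnion.mpr ⟨⟨a, ha⟩, hxa⟩)
  have hρ_smooth : ∀ i, ContDiff ℝ ∞ fun x => (((ρ i x : ℝ)) : ℂ) := fun i =>
    Complex.ofRealCLM.contDiff.comp (ρ i).contMDiff.contDiff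
  let Ψ : t → 𝓢(RSpace 3, ℂ) := fun i =>
    HasCompactSupport.toSchwartzMap (f := fun x => ((ρ i x : ℝ) : ℂ) * ψ x) hψ.mul_left
      ((hρ_smooth i).mul (ψ.smooth ⊤))
  have hΨ : ∀ i, f (Ψ i) = 0 := by
    intro i
    refine i.1.2.1 (Ψ i) (Set.Subset.trans ?_ (hρ i))
    refine closure_mono fun x hx => ?_
    have hx' : ((ρ i x : ℝ) : ℂ) * ψ x ≠ 0 := hx
    have := left_ne_zero_of_mul hx'
    exact_mod_cast this
  have hsum : ψ = ∑ i, Ψ i := by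
    ext x
    rw [sum_apply]
    have h1 : ∀ i, Ψ i x = ((ρ i x : ℝ) : ℂ) * ψ x := fun i => rfl
    simp only [h1, ← Finset.sum_mul]
    by_cases hx : x ∈ tsupport ψ
    · have h2 := ρ.sum_eq_one hx
      rw [finsum_eq_sum_of_fintype] at h2
      have h3 : ∑ i, ((ρ i x : ℝ) : ℂ) = 1 := by exact_mod_cast h2
      rw [h3, one_mul]
    · rw [image_eq_zero_of_notMem_tsupport hx, mul_zero]
  rw [hsum, map_sum]
  exact Finset.sum_eq_zero fun i _ => hΨ i

/-- The pairing `⟨f, χ R_k φ⟩` does not depend on the cutoff function `χ`. -/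
theorem apply_cutoffResolvent_congr (k : ℝ) (f : 𝓢'(RSpace 3, ℂ)) {χ χ' : TestFn} (φ : TestFn)
    (h : ∀ᶠ x in 𝓝ˢ (Distribution.dsupport f), χ.toFun x = 1)
    (h' : ∀ᶠ x in 𝓝ˢ (Distribution.dsupport f), χ'.toFun x = 1) :
    f (cutoffResolvent k χ φ) = f (cutoffResolvent k χ' φ) := by
  rw [← sub_eq_zero, ← map_sub]
  have happ : ∀ x, (cutoffResolvent k χ φ - cutoffResolvent k χ' φ) x =
      (χ.toFun x - χ'.toFun x) * resolvent k φ.toFun x := fun x => by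
    rw [sub_apply, cutoffResolvent_apply, cutoffResolvent_apply, sub_mul]
  refine apply_eq_zero_of_disjoint_dsupport f _ ?_ fun x hx hxf => ?_
  · refine HasCompactSupport.sub ?_ ?_
    · exact χ.compactSupport.mul_right
    · exact χ'.compactSupport.mul_right
  · have h1 : ∀ᶠ y in 𝓝 x, χ.toFun y = 1 := h.filter_mono (nhds_le_nhdsSet hxf)
    have h2 : ∀ᶠ y in 𝓝 x, χ'.toFun y = 1 := h'.filter_mono (nhds_le_nhdsSet hxf)
    refine (notMem_tsupport_iff_eventuallyEq.mpr ?_) hx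
    filter_upwards [h1, h2] with y hy1 hy2
    rw [happ, hy1, hy2]
    simp

/-! ### The resolvent of the random field -/

/-- One cutoff serves every subset of $D$, hence almost every realisation, whose support is random.
-/
theorem exists_testFn_eq_one {D : Set (RSpace 3)} (hD : Bornology.IsBounded D) :
    ∃ χ : TestFn, ∀ s ⊆ D, ∀ᶠ x in 𝓝ˢ s, χ.toFun x = 1 := by
  obtain ⟨R, hR⟩ := hD.subset_ball 0
  let b : ContDiffBump (0 : RSpace 3) :=
    { rIn := |R| + 1, rOut := |R| + 2, rIn_pos := by positivity, rIn_lt_rOut := by linarith }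
  refine ⟨⟨fun x => (b x : ℂ), Complex.ofRealCLM.contDiff.comp b.contDiff,
    b.hasCompactSupport.comp_left (g := fun t : ℝ => (t : ℂ)) (by simp)⟩, fun s hs => ?_⟩
  have h1 : Metric.ball (0 : RSpace 3) R ∈ 𝓝ˢ s :=
    Metric.isOpen_ball.mem_nhdsSet.mpr (hs.trans hR)
  filter_upwards [h1] with x hx
  have h2 : b x = 1 := b.one_of_mem_closedBall (by
    rw [Metric.mem_ball] at hx
    rw [Metric.mem_closedBall]
    exact hx.le.trans ((le_abs_self R).trans (by simp [b])))
  simp [h2]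

/-- Almost surely, `φ ↦ ⟨f, χ R_k φ⟩` is represented by an element of `L²` with respect to the
weighted embedding. -/
theorem IsMigrField.ae_exists_inner_eq {Ω : Type*} [MeasurableSpace Ω]
    {P : Measure Ω} [IsProbabilityMeasure P] {f : Ω → 𝓢'(RSpace 3, ℂ)} {m : ℝ}
    {μ : RSpace 3 → ℝ} {D : Set (RSpace 3)} (hf : IsMigrField P f m μ D) (hm : 3 < 2 * m)
    (k : ℝ) (χ : TestFn) {δ : ℝ} (hδ : 1 / 4 < δ) :
    ∀ᵐ w ∂P, ∃ h : Lp ℂ 2 (volume : Measure (RSpace 3)), ∀ φ : compactSchwartz,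
      f w (cutoffResolventLM k χ φ) = inner ℂ h (weightedToL2 δ φ.1) := by
  obtain ⟨s, hs⟩ := exists_dense_seq_compactSchwartz
  obtain ⟨ι, _, v, hv, hsv⟩ := exists_orthonormal_comp_span
    ((weightedToL2 δ).toLinearMap ∘ₗ compactSchwartz.subtype)
    ((weightedToL2_injective δ).comp Subtype.val_injective) s
  obtain ⟨C, hC0, hC⟩ := hf.exists_lintegral_sq_le (by exact_mod_cast hm)
    χ.compactSupport.isCompact
  obtain ⟨M, hM, hMv⟩ := exists_tsum_lintegral_cutoffResolventLM_le k χ hδ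
  have hle : ∀ i, ∫⁻ w, ‖f w (cutoffResolventLM k χ (v i))‖ₑ ^ 2 ∂P ≤
      ENNReal.ofReal C * ∫⁻ x, ‖cutoffResolventLM k χ (v i) x‖ₑ ^ 2 := by
    intro i
    refine (hC _ fun x hx => ?_).trans (le_of_eq ?_)
    · rw [cutoffResolventLM_apply, image_eq_zero_of_notMem_tsupport hx, zero_mul]
    · rw [ENNReal.ofReal_mul hC0,
        ofReal_integral_sq_norm ((cutoffResolventLM k χ (v i)).memLp 2 volume)]
  have hmeas : ∀ i, AEMeasurable (fun w => ‖f w (cutoffResolventLM k χ (v i))‖ₑ ^ 2) P :=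
    fun i => (hf.gaussian _).aemeasurable.enorm.pow_const 2
  have hfin : ∫⁻ w, ∑' i, ‖f w (cutoffResolventLM k χ (v i))‖ₑ ^ 2 ∂P ≠ ⊤ := by
    rw [lintegral_tsum hmeas]
    refine ne_top_of_le_ne_top (ENNReal.mul_ne_top (ENNReal.ofReal_ne_top (r := C)) hM)
      ((ENNReal.tsum_le_tsum hle).trans ?_)
    rw [ENNReal.tsum_mul_left]
    gcongr
    exact hMv v hv
  -- The only null set discarded in this proof; the rest is deterministic in `w`.
  filter_upwards [ae_lt_top' (AEMeasurable.tsum hmeas) hfin] with w hw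
  have hsum : Summable fun i => ‖f w (cutoffResolventLM k χ (v i))‖ ^ 2 := by
    have h1 := ENNReal.summable_toReal hw.ne
    simpa using h1
  obtain ⟨h, hh⟩ := Orthonormal.exists_inner_eq hv hsum
  have hspan : ∀ φ ∈ Submodule.span ℂ (Set.range v),
      f w (cutoffResolventLM k χ φ) = inner ℂ h (weightedToL2 δ φ.1) := by
    intro φ hφ
    induction hφ using Submodule.span_induction with
    | mem φ hφ =>
      obtain ⟨i, rfl⟩ := hφ
      exact (hh i).symm
    | zero => simp
    | add φ ψ _ _ h₁ h₂ => simp [inner_add_right, h₁, h₂]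
    | smul c φ _ h₁ => simp [inner_smul_right, h₁]
  refine ⟨h, fun φ => ?_⟩
  obtain ⟨N, u, hus, huN, hφN, hu⟩ := hs φ
  have hl1 : Tendsto (fun j => f w (cutoffResolventLM k χ (u j))) atTop
      (𝓝 (f w (cutoffResolventLM k χ φ))) :=
    ((map_continuous (f w)).tendsto _).comp (tendsto_cutoffResolventLM k χ huN hφN hu)
  have hl2 : Tendsto (fun j => inner ℂ h (weightedToL2 δ (u j).1)) atTop
      (𝓝 (inner ℂ h (weightedToL2 δ φ.1))) :=
    (((innerSL ℂ h).continuous.comp (weightedToL2 δ).continuous).tendsto _).comp hu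
  refine tendsto_nhds_unique hl1 (hl2.congr fun j => (hspan _ ?_).symm)
  obtain ⟨n, hn⟩ := hus j
  exact hn ▸ hsv n

theorem MemWeightedL2.mono {n : ℕ} {δ δ' : ℝ} (h : δ ≤ δ') {u : RSpace n → ℂ}
    (hu : MemWeightedL2 δ' u) : MemWeightedL2 δ u := by
  refine ⟨hu.1, hu.2.mono ?_ (Eventually.of_forall fun x => ?_)⟩
  · have h1 : Measurable fun x : RSpace n => (((1 + ‖x‖ ^ 2) ^ (δ / 2) : ℝ) : ℂ) := by fun_prop
    exact h1.aestronglyMeasurable.mul hu.1.aestronglyMeasurable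
  · simp only [norm_mul, Complex.norm_real]
    rw [Real.norm_of_nonneg (by positivity), Real.norm_of_nonneg (by positivity)]
    gcongr
    nlinarith [sq_nonneg ‖x‖]

/-- `MemWeightedL2` halves its exponent, so $-2\delta$ cancels the weight exactly and leaves $\bar
h$. -/
theorem memWeightedL2_weight_mul_conj {n : ℕ} (δ : ℝ)
    (h : Lp ℂ 2 (volume : Measure (RSpace n))) :
    MemWeightedL2 (-(2 * δ)) fun x => (((1 + ‖x‖ ^ 2) ^ δ : ℝ) : ℂ) * conj (h x) := by
  have hL : MemLp (fun x => conj (h x)) 2 (volume : Measure (RSpace n)) := (Lp.memLp h).star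
  refine ⟨?_, ?_⟩
  · have hcont : Continuous fun x : RSpace n => (((1 + ‖x‖ ^ 2) ^ δ : ℝ) : ℂ) := by
      refine Complex.continuous_ofReal.comp (Continuous.rpow_const (by fun_prop) fun x => ?_)
      exact Or.inl (by positivity)
    have h1 := (hL.locallyIntegrable (by norm_num)).locallyIntegrableOn Set.univ
    rw [← locallyIntegrableOn_univ]
    exact h1.continuousOn_mul hcont.continuousOn isOpen_univ.isLocallyClosed
  · refine hL.ae_eq (Eventually.of_forall fun x => ?_)
    have h0 : (0 : ℝ) < 1 + ‖x‖ ^ 2 := by positivity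
    have h1 : (((1 + ‖x‖ ^ 2) ^ (-(2 * δ) / 2) : ℝ) : ℂ) * (((1 + ‖x‖ ^ 2) ^ δ : ℝ) : ℂ) = 1 := by
      rw [← Complex.ofReal_mul, ← Real.rpow_add h0]
      simp [show -(2 * δ) / 2 + δ = 0 by ring]
    simp only
    rw [← mul_assoc, h1, one_mul]

theorem IsMigrField.ae_resolventMemWeightedL2 {Ω : Type*} [MeasurableSpace Ω]
    {P : Measure Ω} [IsProbabilityMeasure P] {f : Ω → 𝓢'(RSpace 3, ℂ)} {m : ℝ}
    {μ : RSpace 3 → ℝ} {D : Set (RSpace 3)} (hf : IsMigrField P f m μ D) (hm : 3 < 2 * m)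
    (hD : Bornology.IsBounded D) (k : ℝ) {δ : ℝ} (hδ : 1 / 4 < δ) :
    ∀ᵐ w ∂P, ResolventMemWeightedL2 k (f w) (-(2 * δ)) := by
  obtain ⟨χ₀, hχ₀⟩ := exists_testFn_eq_one hD
  filter_upwards [hf.ae_exists_inner_eq hm k χ₀ hδ, hf.support_subset] with w ⟨h, hh⟩ hsupp
  have hmem := memWeightedL2_weight_mul_conj δ h
  refine ⟨_, ⟨?_, hmem.1, fun χ φ hχ => ?_⟩, hmem⟩
  · exact Metric.isCompact_of_isClosed_isBounded Distribution.isClosed_dsupport (hD.subset hsupp)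
  · rw [apply_cutoffResolvent_congr k (f w) φ hχ (hχ₀ _ hsupp)]
    refine (hh φ.toCompactSchwartz).trans ?_
    rw [L2.inner_def]
    refine integral_congr_ae ?_
    filter_upwards [coeFn_weightedToL2 δ φ.toCompactSchwartz.1] with x hx
    have hφx : φ.toCompactSchwartz.1 x = φ.toFun x := rfl
    rw [hx, hφx, RCLike.inner_apply]
    ring

end

end RandomScattering

theorem lemma2p2 {Ω : Type*} [MeasurableSpace Ω] (P : Measure Ω) [IsProbabilityMeasure P]
    (f : Ω → 𝓢'(RandomScattering.RSpace 3, ℂ)) (m : ℝ) (hm : 2 < m)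
    (μ : RandomScattering.RSpace 3 → ℝ)
    (D : Set (RandomScattering.RSpace 3)) (hD : Bornology.IsBounded D)
    (hf : RandomScattering.IsMigrField P f m μ D)
    (k : ℝ) (hk : 0 < k) :
    ∀ᵐ ω ∂P, ∀ ε : ℝ, 0 < ε →
      RandomScattering.ResolventMemWeightedL2 k (f ω) (-1 / 2 - ε) := by
  -- The exponent equals $-1/2-1/(n+1)$. Countably many exponents give one null set, and any
  -- $\varepsilon>0$ follows by monotonicity in the weight.
  have h : ∀ n : ℕ, ∀ᵐ ω ∂P, RandomScattering.ResolventMemWeightedL2 k (f ω)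
      (-(2 * (1 / 4 + 1 / ((n : ℝ) + 1) / 2))) := fun n =>
    hf.ae_resolventMemWeightedL2 (by linarith) hD k (by
      have : 0 < 1 / ((n : ℝ) + 1) := by positivity
      linarith)
  filter_upwards [ae_all_iff.mpr h] with ω hω ε hε
  obtain ⟨n, hn⟩ := exists_nat_one_div_lt hε
  obtain ⟨u, hu, huL⟩ := hω n
  exact ⟨u, hu, huL.mono (by linarith)⟩
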